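/- Let $v=(v_n)_{n\ge 0}\in\{-1,+1\}^{\mathbb N_0}$ be the Rudin–Shapiro sequence, given by $v_0=1$, $v_{2n}=v_n$, $v_{2n+1}=(-1)^n v_n$ for $n\ge 0$. Let $X_v\subset\{-1,+1\}^{\mathbb Z}$ be the set of all two-sided sequences $x$ such that every finite word $x_nx_{n+1}\dots x_{n+k-1}$ occurs in $v$, with the topology induced from the product topology, and let $\sigma:X_v\to X_v$, $(\sigma x)_n=x_{n+1}$, be the shift. Notation. For a bi-Lipschitz homeomorphism $\phi$ of a compact metric space $(X,\rho)$ let $\Gamma(\phi)$ be the maximum of the Lipschitz constants of $\phi$ and $\phi^{-1}$, and put $\widehat\Gamma_n(\phi)=\max_{i=1,\dots,n}\Gamma(\phi^i)$. Let $\mathcal N_\epsilon(X)$ be the minimal number of open balls of radius $\epsilon/2$ whose union is $X$; the upper box dimension of $X$ is $\limsup_{\epsilon\to0^+}\log\mathcal N_\epsilon(X)/\log(1/\epsilon)$. **Theorem.** For each $d>0$ there exist a compact metric space $(X,\rho)$, a Borel probability measure $\mu$ on $X$ with full support, and a bi-Lipschitz homeomorphism $\phi:X\to X$ preserving $\mu$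 such that: 1. The upper box dimension of $(X,\rho)$ equals $d$. Moreover, there is $\kappa>0$ such that for every $\delta>0$ there is a $\delta$-net in $X$ consisting of at most $\max\{1,\kappa\delta^{-d}\}$ points. 2. There is a nonzero Lipschitz function $f:X\to\mathbb R$ with $\int_X f\,d\mu=0$ that $\phi$ mixes at the speediest possible rate: $(f\circ\phi^k,f)_{L_2(X,\mu)}=0$ for all integers $k\ne0$; in particular $(f\circ\phi^n,f)_{L_2(X,\mu)}\to0$ as $n\to\infty$. 3. There are $c_1,c_2>0$ such that $c_1 n^{1/d}\le\widehat\Gamma_n(\phi)\le c_2 n^{1/d}$ for all integers $n\ge1$. Moreover, $(X,\rho,\phi)$ can be taken to be the Rudin–Shapiro shift with a suitable metric: there is a homeomorphism $h:X\to X_v$ with $h\circ\phi=\sigma\circ h$. -/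

import Mathlib

open MeasureTheory Filter Topology
open scoped NNReal

namespace BiLipGrowth

/-! ### Lipschitz constants and growth -/

/-- `φ` is bi-Lipschitz: both `φ` and its inverse are Lipschitz. -/
def IsBiLipschitz {X : Type*} [MetricSpace X] (φ : X ≃ₜ X) : Prop :=
  (∃ K : ℝ≥0, LipschitzWith K φ) ∧ ∃ K : ℝ≥0, LipschitzWith K φ.symm

/-- The (optimal) Lipschitz constant of a Lipschitz map. It is only used for Lipschitz maps. -/
noncomputable def lipConst {X Y : Type*} [MetricSpace X] [MetricSpace Y] (f : X → Y) : ℝ≥0 :=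
  sInf {K : ℝ≥0 | LipschitzWith K f}

/-- `Γ(φ)`: the maximum of the Lipschitz constants of `φ` and of its inverse. -/
noncomputable def growth {X : Type*} [MetricSpace X] (φ : X ≃ₜ X) : ℝ≥0 :=
  max (lipConst φ) (lipConst φ.symm)

/-- `Γ̂_n(φ) = max_{i = 1, …, n} Γ(φ^i)`; powers are taken in the group of homeomorphisms. -/
noncomputable def growthHat {X : Type*} [MetricSpace X] (φ : X ≃ₜ X) (n : ℕ) : ℝ≥0 :=
  (Finset.Icc 1 n).sup fun i => growth (φ ^ i)

/-! ### Box dimension and nets -/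

/-- The minimal number of open balls of radius `ε / 2` whose union covers `A`. -/
noncomputable def coverNum {X : Type*} [MetricSpace X] (A : Set X) (ε : ℝ) : ℕ :=
  sInf {n : ℕ | ∃ s : Finset X, s.card = n ∧ A ⊆ ⋃ x ∈ s, Metric.ball x (ε / 2)}

/-- The upper box dimension of a compact set `A`, as an extended real number. -/
noncomputable def upperBoxDim {X : Type*} [MetricSpace X] (A : Set X) : EReal :=
  limsup (fun ε : ℝ => ((Real.log (coverNum A ε) / Real.log (1 / ε) : ℝ) : EReal)) (𝓝[>] 0)

/-- The finite set `s` is a `δ`-net in `X`. -/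
def IsNet {X : Type*} [MetricSpace X] (δ : ℝ) (s : Finset X) : Prop :=
  ∀ x : X, ∃ y ∈ s, dist x y ≤ δ

/-! ### Mixing -/

/-- The correlation `(f ∘ φ^k, f)` in `L₂(X, μ)` of a real-valued function `f`, for `k ∈ ℤ`. -/
noncomputable def correlation {X : Type*} [MetricSpace X] [MeasurableSpace X] (μ : Measure X)
    (φ : X ≃ₜ X) (f : X → ℝ) (k : ℤ) : ℝ :=
  ∫ x, f ((φ ^ k) x) * f x ∂μ

/-- `φ` mixes `f`: the correlations `(f ∘ φ^n, f)` tend to `0` as `n → ∞`. -/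
def Mixes {X : Type*} [MetricSpace X] [MeasurableSpace X] (μ : Measure X)
    (φ : X ≃ₜ X) (f : X → ℝ) : Prop :=
  Tendsto (fun n : ℕ => correlation μ φ f n) atTop (𝓝 0)

/-! ### The shift of a one-sided sequence and the Rudin-Shapiro sequence -/

/-- The two-sided subshift of `v`: all two-sided sequences `x` such that every finite word
`x_n x_{n+1} … x_{n+k-1}` occurs in `v`. -/
def subshift {A : Type*} (v : ℕ → A) : Set (ℤ → A) :=
  {x | ∀ (n : ℤ) (k : ℕ), ∃ m : ℕ, ∀ i : ℕ, i < k → x (n + i) = v (m + i)}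

theorem translate_mem_subshift {A : Type*} {v : ℕ → A} {x : ℤ → A} (hx : x ∈ subshift v) (c : ℤ) :
    (fun n => x (n + c)) ∈ subshift v := by
  intro n k
  obtain ⟨m, hm⟩ := hx (n + c) k
  refine ⟨m, fun i hi => ?_⟩
  have h := hm i hi
  rw [show n + c + (i : ℤ) = n + i + c by ring] at h
  exact h

/-- The left shift `(φ x)_n = x_{n+1}` as a homeomorphism of the subshift of `v`, where the
subshift carries the topology induced from the product topology. -/
def shift {A : Type*} [TopologicalSpace A] (v : ℕ → A) : subshift v ≃ₜ subshift v where
  toFun x := ⟨fun n => x.1 (n + 1), translate_mem_subshift x.2 1⟩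
  invFun x := ⟨fun n => x.1 (n + -1), translate_mem_subshift x.2 (-1)⟩
  left_inv x := by
    ext n
    simp
  right_inv x := by
    ext n
    simp
  continuous_toFun := by
    refine Continuous.subtype_mk (continuous_pi fun n => ?_) _
    exact (continuous_apply (n + 1)).comp continuous_subtype_val
  continuous_invFun := by
    refine Continuous.subtype_mk (continuous_pi fun n => ?_) _
    exact (continuous_apply (n + -1)).comp continuous_subtype_val

/-- The Rudin-Shapiro sequence over the alphabet `{-1, +1} = ℤˣ`. -/
def rudinShapiro (n : ℕ) : ℤˣ :=
  if n = 0 then 1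
  else if n % 2 = 0 then rudinShapiro (n / 2)
  else (-1) ^ (n / 2) * rudinShapiro (n / 2)
termination_by n
decreasing_by all_goals omega

theorem rudinShapiro_zero : rudinShapiro 0 = 1 := by
  rw [rudinShapiro]
  simp

theorem rudinShapiro_two_mul (n : ℕ) : rudinShapiro (2 * n) = rudinShapiro n := by
  rcases Nat.eq_zero_or_pos n with rfl | hn
  · rfl
  · rw [rudinShapiro, if_neg (by omega), if_pos (by omega), show 2 * n / 2 = n by omega]

theorem rudinShapiro_two_mul_add_one (n : ℕ) :
    rudinShapiro (2 * n + 1) = (-1) ^ n * rudinShapiro n := by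
  rw [rudinShapiro, if_neg (by omega), if_neg (by omega), show (2 * n + 1) / 2 = n by omega]

end BiLipGrowth

namespace BiLipGrowth

/-! ### Arithmetic of the Rudin-Shapiro sequence -/

/-! The Rudin–Shapiro shift combines two properties: it has only linearly many words, and the
coordinate at the origin is uncorrelated with all of its shifts. The metric is then fitted to the
dimension. Two points that first differ at distance `N` from the origin are at distance `(N + 1) ^
(-1 / d)`, so a ball of radius `δ` fixes about `δ ^ (-d)` coordinates. Linear complexity turns this
into covering numbers of order `δ ^ (-d)`. The upper bound (`exists_window_net`) holds because a
word of length `2 ^ k` meets at most two aligned blocks, each determined by a parity and a sign. The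
lower bound (`exists_window_separated`) needs only that the shift is infinite, that is, that the
sequence is not eventually periodic.

Shifting by `n` moves the closest difference by at most `n`, which bounds the growth by `(n + 1) ^
(1 / d)`. A pair that first differs exactly at distance `n` (`exists_firstDiff_eq`) attains this
bound.

The measure is a limit of empirical measures over the first `2 ^ k` iterates of a point extending
the sequence to the left. Along these times the sums of `v` have size `O(2 ^ (k / 2))`
(`sq_sum_rudinShapiro`), and the correlation sums at each fixed distance `j ≥ 1` stay bounded
(`corrSum_bounded`). After averaging, both vanish in the limit. Full support follows from invariance
and from the recurrence of every prefix with bounded gaps. -/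

theorem rudinShapiro_two_pow_mul_add {m m' : ℕ} (hmod : m % 2 = m' % 2)
    (hv : rudinShapiro m = rudinShapiro m') (k : ℕ) :
    ∀ r, r < 2 ^ k → rudinShapiro (2 ^ k * m + r) = rudinShapiro (2 ^ k * m' + r) := by
  -- Appending a binary digit to an index multiplies the value by a sign that depends only on the
  -- digit and the parity of the index, so the parity has to be carried through the induction.
  suffices H : ∀ r, r < 2 ^ k → rudinShapiro (2 ^ k * m + r) = rudinShapiro (2 ^ k * m' + r) ∧
      (2 ^ k * m + r) % 2 = (2 ^ k * m' + r) % 2 from fun r hr => (H r hr).1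
  induction k with
  | zero =>
    intro r hr
    obtain rfl : r = 0 := by omega
    simpa using ⟨hv, hmod⟩
  | succ k ih =>
    intro r hr
    obtain ⟨h1, h2⟩ := ih (r / 2) (by rw [pow_succ] at hr; omega)
    have hpar : ∀ a : ℕ, 2 ^ (k + 1) * a + r = 2 * (2 ^ k * a + r / 2) + r % 2 := fun a => by
      rw [pow_succ, mul_comm (2 ^ k) 2, mul_assoc]; omega
    refine ⟨?_, by rw [hpar, hpar]; omega⟩
    rw [hpar, hpar]
    rcases Nat.mod_two_eq_zero_or_one r with h | h
    · rw [h, add_zero, add_zero, rudinShapiro_two_mul, rudinShapiro_two_mul, h1]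
    · rw [h, rudinShapiro_two_mul_add_one, rudinShapiro_two_mul_add_one, h1,
        neg_one_pow_congr (n := 2 ^ k * m' + r / 2) (by simp only [Nat.even_iff, h2])]

theorem rudinShapiro_one : rudinShapiro 1 = 1 := by
  simpa [rudinShapiro_zero] using rudinShapiro_two_mul_add_one 0

theorem rudinShapiro_two : rudinShapiro 2 = 1 := by
  simpa [rudinShapiro_one] using rudinShapiro_two_mul 1

theorem rudinShapiro_eight : rudinShapiro 8 = 1 := by
  rw [rudinShapiro_two_mul 4, rudinShapiro_two_mul 2, rudinShapiro_two]

theorem rudinShapiro_seven : rudinShapiro 7 = 1 := by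
  rw [rudinShapiro_two_mul_add_one 3, rudinShapiro_two_mul_add_one 1, rudinShapiro_one]
  decide

/-- The prefix of length `2 ^ k` recurs in the Rudin-Shapiro sequence with bounded gaps. -/
theorem rudinShapiro_recurrent (k p : ℕ) :
    ∃ n, p ≤ n ∧ n < p + 16 * 2 ^ k ∧ ∀ i < 2 ^ k, rudinShapiro (n + i) = rudinShapiro i := by
  have key : ∀ q, q % 2 = 0 → rudinShapiro q = 1 →
      ∀ i < 2 ^ k, rudinShapiro (2 ^ k * q + i) = rudinShapiro i := fun q h0 h1 i hi => by
    have := rudinShapiro_two_pow_mul_add (m := q) (m' := 0) (by omega)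
      (by rw [h1, rudinShapiro_zero]) k i hi
    simpa using this
  obtain ⟨j, hj⟩ : ∃ j, j = p / (8 * 2 ^ k) := ⟨_, rfl⟩
  have hpos : 0 < 2 ^ k := by positivity
  have h1 : 8 * 2 ^ k * j ≤ p := by rw [hj]; exact Nat.mul_div_le _ _
  have h2 : p < 8 * 2 ^ k * (j + 1) := by
    rw [hj]; exact Nat.lt_mul_div_succ p (by positivity)
  -- The blocks numbered `8 * j + 12` and `8 * j + 14` are both even and have opposite signs, so one
  -- of them has parity and sign equal to those of block `0` and repeats the prefix.
  have e1 : rudinShapiro (8 * j + 12) = rudinShapiro (2 * j + 3) := by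
    rw [show 8 * j + 12 = 2 * (2 * (2 * j + 3)) by ring, rudinShapiro_two_mul,
      rudinShapiro_two_mul]
  have e2 : rudinShapiro (8 * j + 14) = -rudinShapiro (2 * j + 3) := by
    rw [show 8 * j + 14 = 2 * (2 * (2 * j + 3) + 1) by ring, rudinShapiro_two_mul,
      rudinShapiro_two_mul_add_one, Odd.neg_one_pow ⟨j + 1, by ring⟩]
    simp
  rcases Int.units_eq_one_or (rudinShapiro (2 * j + 3)) with h | h
  · exact ⟨2 ^ k * (8 * j + 12), by nlinarith, by nlinarith,
      key _ (by omega) (by rw [e1, h])⟩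
  · exact ⟨2 ^ k * (8 * j + 14), by nlinarith, by nlinarith,
      key _ (by omega) (by rw [e2, h]; simp)⟩

/-- The word of length `2 ^ k` at position `n` depends only on a code with `16 * 2 ^ k` values. -/
theorem exists_rudinShapiro_code (k : ℕ) :
    ∃ code : ℕ → (Fin (2 ^ k) × (Fin 2 × ℤˣ) × (Fin 2 × ℤˣ)), ∀ n n', code n = code n' →
      ∀ i < 2 ^ k, rudinShapiro (n + i) = rudinShapiro (n' + i) := by
  have hpos : 0 < 2 ^ k := by positivity
  -- A window of length `2 ^ k` lies in two consecutive aligned blocks. The code records its offset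
  -- and the parity and sign of each of the two blocks.
  refine ⟨fun n => (⟨n % 2 ^ k, Nat.mod_lt _ hpos⟩,
    (⟨(n / 2 ^ k) % 2, Nat.mod_lt _ two_pos⟩, rudinShapiro (n / 2 ^ k)),
    (⟨(n / 2 ^ k + 1) % 2, Nat.mod_lt _ two_pos⟩, rudinShapiro (n / 2 ^ k + 1))), ?_⟩
  intro n n' h i hi
  simp only [Prod.mk.injEq, Fin.mk.injEq] at h
  obtain ⟨hr, ⟨hp, hv⟩, hp', hv'⟩ := h
  have hn := Nat.div_add_mod n (2 ^ k)
  have hn' := Nat.div_add_mod n' (2 ^ k)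
  have hlt := Nat.mod_lt n hpos
  generalize n / 2 ^ k = q at *
  generalize n' / 2 ^ k = q' at *
  rw [← hr] at hn'
  generalize n % 2 ^ k = r at *
  rw [← hn, ← hn', add_assoc, add_assoc]
  rcases lt_or_ge (r + i) (2 ^ k) with h | h
  · exact rudinShapiro_two_pow_mul_add hp hv k _ h
  · obtain ⟨s, hs⟩ := Nat.exists_eq_add_of_le h
    have := rudinShapiro_two_pow_mul_add hp' hv' k s (by omega)
    rwa [mul_add, mul_add, mul_one, add_assoc, add_assoc, ← hs] at this

/-! ### A two-sided extension -/

/-- Around `2 * 4 ^ (K + 1) = 8 * 4 ^ K` lie the blocks 7 and 8 of length `4 ^ K`. They repeat the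
blocks 1 and 2 around `2 * 4 ^ K`, since parities and signs agree. The words around these centers
therefore extend one another and converge to a two-sided sequence. -/
theorem rudinShapiro_center {K K' : ℕ} (hK : K ≤ K') {i : ℤ} (hi : i.natAbs < 4 ^ K) :
    rudinShapiro (2 * 4 ^ K' + i).toNat = rudinShapiro (2 * 4 ^ K + i).toNat := by
  induction K', hK using Nat.le_induction with
  | base => rfl
  | succ K' hK ih =>
    rw [← ih]
    have hi' : i.natAbs < 2 ^ (2 * K') := by
      rw [pow_mul]; exact hi.trans_le (Nat.pow_le_pow_right (by norm_num) hK)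
    have h4 : (4 : ℤ) ^ K' = ((2 ^ (2 * K') : ℕ) : ℤ) := by
      rw [pow_mul]; norm_num
    rw [pow_succ, h4]
    generalize hN : 2 ^ (2 * K') = N at *
    rcases lt_or_ge i 0 with h | h
    · have := rudinShapiro_two_pow_mul_add (m := 7) (m' := 1) (by norm_num)
        (by rw [rudinShapiro_seven, rudinShapiro_one]) (2 * K') (N - i.natAbs) (by omega)
      rw [hN] at this
      convert this using 2 <;> omega
    · have := rudinShapiro_two_pow_mul_add (m := 8) (m' := 2) (by norm_num)
        (by rw [rudinShapiro_eight, rudinShapiro_two]) (2 * K') i.natAbs (by omega)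
      rw [hN] at this
      convert this using 2 <;> omega

/-- There is a point of the Rudin-Shapiro shift whose right half is the Rudin-Shapiro sequence. -/
theorem exists_extension_rudinShapiro :
    ∃ x ∈ subshift rudinShapiro, ∀ i : ℕ, x i = rudinShapiro i := by
  have hlt : ∀ a : ℕ, a < 4 ^ a := fun a => Nat.lt_pow_self (by norm_num)
  refine ⟨fun i => rudinShapiro (2 * 4 ^ i.natAbs + i).toNat, ?_, ?_⟩
  · intro n k
    have hn := hlt (n.natAbs + k)
    have hcast : ((4 ^ (n.natAbs + k) : ℕ) : ℤ) = 4 ^ (n.natAbs + k) := by push_cast; rfl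
    refine ⟨(2 * 4 ^ (n.natAbs + k) + n).toNat, fun i hi => ?_⟩
    dsimp only
    rw [← rudinShapiro_center (K' := n.natAbs + k) (by omega) (hlt (n + i).natAbs)]
    congr 1
    omega
  · intro i
    have h := rudinShapiro_two_pow_mul_add (m := 2) (m' := 0) (by norm_num)
      (by rw [rudinShapiro_two, rudinShapiro_zero]) (2 * i) i
      (by rw [pow_mul]; exact hlt i)
    simp only [Int.natAbs_natCast]
    rw [mul_zero, zero_add] at h
    rw [← h, pow_mul]
    congr 1
    have hcast : ((4 ^ i : ℕ) : ℤ) = 4 ^ i := by push_cast; rfl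
    norm_num
    omega

/-! ### Means and correlations -/

theorem sum_range_two_pow_succ (f : ℕ → ℤ) (k : ℕ) :
    ∑ n ∈ Finset.range (2 ^ (k + 1)), f n =
      ∑ n ∈ Finset.range (2 ^ k), (f (2 * n) + f (2 * n + 1)) := by
  rw [pow_succ, mul_comm]
  induction 2 ^ k with
  | zero => simp
  | succ N ih =>
    rw [mul_add, mul_one, Finset.sum_range_succ, Finset.sum_range_succ, ih,
      Finset.sum_range_succ]
    ring

/-- The partial sums of length `2 ^ k` of the Rudin-Shapiro sequence have square-root size. -/
theorem sq_sum_rudinShapiro (k : ℕ) :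
    (∑ n ∈ Finset.range (2 ^ k), (rudinShapiro n : ℤ)) ^ 2 +
      (∑ n ∈ Finset.range (2 ^ k), (-1) ^ n * (rudinShapiro n : ℤ)) ^ 2 = 2 * 2 ^ k := by
  induction k with
  | zero => simp [rudinShapiro_zero]
  | succ k ih =>
    rw [sum_range_two_pow_succ, sum_range_two_pow_succ]
    simp only [rudinShapiro_two_mul, rudinShapiro_two_mul_add_one, pow_add, pow_mul, pow_one,
      Units.val_mul, Units.val_pow_eq_pow_val, Units.val_neg, Units.val_one, Finset.sum_add_distrib,
      neg_one_sq, one_pow, one_mul, neg_one_mul, Finset.sum_neg_distrib]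
    -- If `S` and `T` are the plain and the alternating sum, the next pair is `S + T`, `S - T`, and
    -- the parallelogram law doubles the sum of squares.
    linear_combination 2 * ih

/-- The correlation sum of length `2 ^ k` at distance `j`. -/
def corrSum (k j : ℕ) : ℤ :=
  ∑ n ∈ Finset.range (2 ^ k), (rudinShapiro n : ℤ) * rudinShapiro (n + j)

/-- The alternating correlation sum of length `2 ^ k` at distance `j`. -/
def altCorrSum (k j : ℕ) : ℤ :=
  ∑ n ∈ Finset.range (2 ^ k), (-1) ^ n * ((rudinShapiro n : ℤ) * rudinShapiro (n + j))

/-- Splitting a sum into even and odd indices halves the distance: `2 * j` leads to `j`, and `2 * j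
+ 1` leads to `j` and `j + 1`. These recursions carry the bound on all correlations. -/
theorem corrSum_even (k j : ℕ) : corrSum (k + 1) (2 * j) = (1 + (-1) ^ j) * corrSum k j := by
  rw [corrSum, corrSum, sum_range_two_pow_succ, Finset.mul_sum]
  refine Finset.sum_congr rfl fun n _ => ?_
  rw [show 2 * n + 2 * j = 2 * (n + j) by ring, show 2 * n + 1 + 2 * j = 2 * (n + j) + 1 by ring]
  simp only [rudinShapiro_two_mul, rudinShapiro_two_mul_add_one, Units.val_mul,
    Units.val_pow_eq_pow_val, Units.val_neg, Units.val_one]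
  rcases neg_one_pow_eq_or ℤ n with h | h <;> rw [pow_add, h] <;> ring

theorem altCorrSum_even (k j : ℕ) :
    altCorrSum (k + 1) (2 * j) = (1 - (-1) ^ j) * corrSum k j := by
  rw [altCorrSum, corrSum, sum_range_two_pow_succ, Finset.mul_sum]
  refine Finset.sum_congr rfl fun n _ => ?_
  rw [show 2 * n + 2 * j = 2 * (n + j) by ring, show 2 * n + 1 + 2 * j = 2 * (n + j) + 1 by ring]
  simp only [rudinShapiro_two_mul, rudinShapiro_two_mul_add_one, Units.val_mul,
    Units.val_pow_eq_pow_val, Units.val_neg, Units.val_one, pow_succ, pow_mul]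
  rcases neg_one_pow_eq_or ℤ n with h | h <;> rw [pow_add, h] <;> norm_num <;> ring

theorem corrSum_odd (k j : ℕ) :
    corrSum (k + 1) (2 * j + 1) = (-1) ^ j * altCorrSum k j + altCorrSum k (j + 1) := by
  rw [corrSum, altCorrSum, altCorrSum, sum_range_two_pow_succ, Finset.mul_sum,
    ← Finset.sum_add_distrib]
  refine Finset.sum_congr rfl fun n _ => ?_
  rw [show 2 * n + (2 * j + 1) = 2 * (n + j) + 1 by ring,
    show 2 * n + 1 + (2 * j + 1) = 2 * (n + (j + 1)) by ring]
  simp only [rudinShapiro_two_mul, rudinShapiro_two_mul_add_one, Units.val_mul,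
    Units.val_pow_eq_pow_val, Units.val_neg, Units.val_one, pow_add]
  ring

theorem altCorrSum_odd (k j : ℕ) :
    altCorrSum (k + 1) (2 * j + 1) = (-1) ^ j * altCorrSum k j - altCorrSum k (j + 1) := by
  rw [altCorrSum, altCorrSum, altCorrSum, sum_range_two_pow_succ, Finset.mul_sum,
    ← Finset.sum_sub_distrib]
  refine Finset.sum_congr rfl fun n _ => ?_
  rw [show 2 * n + (2 * j + 1) = 2 * (n + j) + 1 by ring,
    show 2 * n + 1 + (2 * j + 1) = 2 * (n + (j + 1)) by ring]
  simp only [rudinShapiro_two_mul, rudinShapiro_two_mul_add_one, Units.val_mul,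
    Units.val_pow_eq_pow_val, Units.val_neg, Units.val_one, pow_add, pow_mul]
  norm_num
  ring

theorem abs_altCorrSum_zero_le (k : ℕ) : |altCorrSum k 0| ≤ 1 := by
  rcases k with _ | k
  · simp [altCorrSum]
  · have := altCorrSum_even k 0
    simp_all

theorem altCorrSum_succ_zero (k : ℕ) : altCorrSum (k + 1) 0 = 0 := by
  simpa using altCorrSum_even k 0

/-- Distance 1 is the one positive distance whose recursion refers back to itself. The other term,
at distance 0, vanishes for positive `k`, so only a sign change remains. -/
theorem abs_altCorrSum_one_le (k : ℕ) : |altCorrSum k 1| ≤ 2 := by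
  have h : |altCorrSum 0 1| ≤ 1 := by simp [altCorrSum, rudinShapiro_zero, rudinShapiro_one]
  have h1 := abs_altCorrSum_zero_le 0
  suffices H : ∀ k, |altCorrSum (k + 1) 1| ≤ 2 by
    rcases k with _ | k
    · omega
    · exact H k
  intro k
  induction k with
  | zero =>
    have := altCorrSum_odd 0 0
    simp only [mul_zero, zero_add, pow_zero, one_mul] at this
    rw [this]
    exact (abs_sub _ _).trans (by linarith)
  | succ k ih =>
    have := altCorrSum_odd (k + 1) 0
    simp only [mul_zero, zero_add, pow_zero, altCorrSum_succ_zero, zero_sub] at this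
    rw [this, abs_neg]
    exact ih

theorem bounded_of_succ {f : ℕ → ℤ} {B : ℤ} (h : ∀ k, |f (k + 1)| ≤ B) :
    ∃ B, ∀ k, |f k| ≤ B := by
  refine ⟨max |f 0| B, fun k => ?_⟩
  rcases k with _ | k
  · exact le_max_left _ _
  · exact (h k).trans (le_max_right _ _)

theorem corrSum_bounded (j : ℕ) (hj : 1 ≤ j) :
    (∃ B, ∀ k, |corrSum k j| ≤ B) ∧ ∃ B, ∀ k, |altCorrSum k j| ≤ B := by
  induction j using Nat.strong_induction_on with
  | _ j ih =>
    rcases Nat.even_or_odd' j with ⟨i, rfl | rfl⟩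
    · obtain ⟨⟨B, hB⟩, -⟩ := ih i (by omega) (by omega)
      constructor
      · refine bounded_of_succ (B := 2 * B) fun k => ?_
        have := hB k
        have := abs_nonneg (corrSum k i)
        rw [corrSum_even]
        rcases neg_one_pow_eq_or ℤ i with h | h <;> rw [h, abs_mul] <;> norm_num <;> linarith
      · refine bounded_of_succ (B := 2 * B) fun k => ?_
        have := hB k
        have := abs_nonneg (corrSum k i)
        rw [altCorrSum_even]
        rcases neg_one_pow_eq_or ℤ i with h | h <;> rw [h, abs_mul] <;> norm_num <;> linarith
    · obtain ⟨B, hB⟩ : ∃ B, ∀ k, |altCorrSum k i| ≤ B := by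
        rcases Nat.eq_zero_or_pos i with rfl | hi
        · exact ⟨1, abs_altCorrSum_zero_le⟩
        · exact (ih i (by omega) hi).2
      obtain ⟨B', hB'⟩ : ∃ B, ∀ k, |altCorrSum k (i + 1)| ≤ B := by
        rcases Nat.eq_zero_or_pos i with rfl | hi
        · exact ⟨2, abs_altCorrSum_one_le⟩
        · exact (ih (i + 1) (by omega) (by omega)).2
      constructor
      · refine bounded_of_succ (B := B + B') fun k => ?_
        rw [corrSum_odd]
        refine (abs_add_le _ _).trans ?_
        rw [abs_mul, abs_pow, abs_neg, abs_one, one_pow, one_mul]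
        exact add_le_add (hB k) (hB' k)
      · refine bounded_of_succ (B := B + B') fun k => ?_
        rw [altCorrSum_odd]
        refine (abs_sub _ _).trans ?_
        rw [abs_mul, abs_pow, abs_neg, abs_one, one_pow, one_mul]
        exact add_le_add (hB k) (hB' k)

/-- The Rudin-Shapiro sequence is not eventually periodic. -/
theorem rudinShapiro_not_periodic (a p : ℕ) (hp : 1 ≤ p) :
    ¬ ∀ n, a ≤ n → rudinShapiro (n + p) = rudinShapiro n := by
  intro h
  obtain ⟨⟨B, hB⟩, -⟩ := corrSum_bounded p hp
  -- Under periodicity every product from `a` on equals 1, and each earlier one loses at most 2.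
  -- This linear growth in `2 ^ k` contradicts the bound `B`.
  have key : ∀ k, (2 : ℤ) ^ k - 2 * a ≤ corrSum k p := by
    intro k
    have h1 : ∀ n ∈ Finset.range (2 ^ k), (1 : ℤ) - (if n < a then 2 else 0) ≤
        (rudinShapiro n : ℤ) * rudinShapiro (n + p) := by
      intro n _
      split_ifs with hn
      · rcases Int.units_eq_one_or (rudinShapiro n) with h1 | h1 <;>
        rcases Int.units_eq_one_or (rudinShapiro (n + p)) with h2 | h2 <;> simp [h1, h2]
      · rw [h n (by omega)]
        rcases Int.units_eq_one_or (rudinShapiro n) with h1 | h1 <;> simp [h1]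
    refine le_trans ?_ (Finset.sum_le_sum h1)
    rw [Finset.sum_sub_distrib, ← Finset.sum_filter]
    simp only [Finset.sum_const, Finset.card_range, nsmul_eq_mul, mul_one, Nat.cast_pow,
      Nat.cast_ofNat]
    have : (Finset.filter (fun n => n < a) (Finset.range (2 ^ k))).card ≤ a := by
      refine (Finset.card_le_card (t := Finset.range a) fun n hn => ?_).trans_eq (by simp)
      simpa using (Finset.mem_filter.1 hn).2
    have : ((Finset.filter (fun n => n < a) (Finset.range (2 ^ k))).card : ℤ) ≤ a := by
      exact_mod_cast this
    linarith
  have h1 := key (B.natAbs + 2 * a)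
  have h2 := (le_abs_self _).trans (hB (B.natAbs + 2 * a))
  have h3 : ((B.natAbs + 2 * a : ℕ) : ℤ) < 2 ^ (B.natAbs + 2 * a) := by
    exact_mod_cast Nat.lt_two_pow_self
  omega

/-! ### Invariant measures as limits of empirical measures -/

/-- A Krylov-Bogolyubov theorem along a given sequence of times `N k → ∞`: there is an invariant
probability measure whose integrals are the limits of Birkhoff averages wherever these exist. -/
theorem exists_invariant_measure_of_birkhoff {X : Type*} [TopologicalSpace X] [CompactSpace X]
    [T2Space X] [HasOuterApproxClosed X] [MeasurableSpace X] [BorelSpace X] (φ : X ≃ₜ X) (x₀ : X)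
    {N : ℕ → ℕ} (hN : Tendsto N atTop atTop) (hpos : ∀ k, 0 < N k) :
    ∃ μ : Measure X, IsProbabilityMeasure μ ∧ MeasurePreserving φ μ μ ∧
      ∀ g : X → ℝ, Continuous g → ∀ c : ℝ,
        Tendsto (fun k => (∑ n ∈ Finset.range (N k), g ((φ ^ n) x₀)) / (N k : ℝ)) atTop (𝓝 c) →
        ∫ x, g x ∂μ = c := by
  let m : ℕ → Measure X := fun k =>
    (N k : ENNReal)⁻¹ • ∑ n ∈ Finset.range (N k), Measure.dirac ((φ ^ n) x₀)
  have hm : ∀ k, IsProbabilityMeasure (m k) := fun k => ⟨by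
    simp only [m, Measure.smul_apply, Measure.finsetSum_apply, measure_univ, Finset.sum_const,
      Finset.card_range, nsmul_eq_mul, mul_one, smul_eq_mul]
    exact ENNReal.inv_mul_cancel (by exact_mod_cast (hpos k).ne') (ENNReal.natCast_ne_top _)⟩
  have hint : ∀ (k : ℕ) (g : X → ℝ), ∫ x, g x ∂(m k) =
      (∑ n ∈ Finset.range (N k), g ((φ ^ n) x₀)) / (N k : ℝ) := fun k g => by
    simp only [m]
    rw [integral_smul_measure, integral_finsetSum_measure fun n _ => integrable_dirac (by simp)]
    simp only [integral_dirac, ENNReal.toReal_inv, ENNReal.toReal_natCast, smul_eq_mul]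
    rw [div_eq_inv_mul]
  let P : ℕ → ProbabilityMeasure X := fun k => ⟨m k, hm k⟩
  -- Compactness of the space of probability measures gives a limit along an ultrafilter, without
  -- choosing a subsequence.
  let U : Ultrafilter ℕ := Ultrafilter.of atTop
  have hU : (U : Filter ℕ) ≤ atTop := Ultrafilter.of_le atTop
  obtain ⟨μ, hμ⟩ : ∃ μ : ProbabilityMeasure X, Tendsto P U (𝓝 μ) := ⟨_, (U.map P).le_nhds_lim⟩
  rw [ProbabilityMeasure.tendsto_iff_forall_integral_tendsto] at hμ
  have hlim : ∀ g : X → ℝ, Continuous g →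
      Tendsto (fun k => (∑ n ∈ Finset.range (N k), g ((φ ^ n) x₀)) / (N k : ℝ)) U
        (𝓝 (∫ x, g x ∂(μ : Measure X))) := fun g hg => by
    have := hμ (BoundedContinuousFunction.mkOfCompact ⟨g, hg⟩)
    simp only [BoundedContinuousFunction.mkOfCompact_apply, ContinuousMap.coe_mk] at this
    simpa only [P, ProbabilityMeasure.coe_mk, hint] using this
  refine ⟨μ, inferInstance, ⟨φ.continuous.measurable, ?_⟩, fun g hg c hc =>
    tendsto_nhds_unique (hlim g hg) (hc.mono_left hU)⟩
  have : IsProbabilityMeasure (Measure.map φ (μ : Measure X)) :=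
    Measure.isProbabilityMeasure_map φ.continuous.measurable.aemeasurable
  refine ext_of_forall_integral_eq_of_IsFiniteMeasure fun f => ?_
  rw [integral_map φ.continuous.measurable.aemeasurable
    f.continuous.measurable.aestronglyMeasurable]
  have h1 := (hlim _ (f.continuous.comp φ.continuous)).sub (hlim _ f.continuous)
  refine sub_eq_zero.1 (tendsto_nhds_unique h1 ?_)
  -- The averages of `f ∘ φ` and `f` differ by a telescoping sum, of size at most `2 * ‖f‖ / N k`.
  have h2 : Tendsto (fun k => (2 * ‖f‖) / (N k : ℝ)) U (𝓝 0) :=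
    (tendsto_const_nhds.div_atTop (tendsto_natCast_atTop_atTop.comp hN)).mono_left hU
  refine squeeze_zero_norm (fun k => ?_) h2
  rw [← sub_div, ← Finset.sum_sub_distrib, norm_div, Real.norm_natCast]
  refine div_le_div_of_nonneg_right ?_ (Nat.cast_nonneg _)
  have h3 : ∀ n, (f ∘ φ) ((φ ^ n) x₀) = f ((φ ^ (n + 1)) x₀) := fun n => by
    rw [pow_succ']; rfl
  simp only [h3]
  rw [Finset.sum_range_sub fun n => f ((φ ^ n) x₀), two_mul]
  exact (norm_sub_le _ _).trans (add_le_add (f.norm_coe_le_norm _) (f.norm_coe_le_norm _))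

/-! ### The metric -/

section WindowDist

variable {A : Type*}

/-- The distance to the origin of the closest position where `x` and `y` differ. -/
noncomputable def firstDiff (x y : ℤ → A) : ℕ :=
  sInf {m | ∃ i : ℤ, i.natAbs = m ∧ x i ≠ y i}

open Classical in
/-- The distance `(N + 1) ^ (-1 / d)` of two sequences that first differ at distance `N` from the
origin. -/
noncomputable def windowDist (d : ℝ) (x y : ℤ → A) : ℝ :=
  if x = y then 0 else ((firstDiff x y : ℝ) + 1) ^ (-(1 / d))

theorem eq_of_natAbs_lt_firstDiff {x y : ℤ → A} {i : ℤ} (hi : i.natAbs < firstDiff x y) :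
    x i = y i := by
  by_contra h
  exact Nat.notMem_of_lt_sInf hi ⟨i, rfl, h⟩

theorem firstDiff_le {x y : ℤ → A} {i : ℤ} (hi : x i ≠ y i) : firstDiff x y ≤ i.natAbs :=
  Nat.sInf_le ⟨i, rfl, hi⟩

theorem exists_natAbs_eq_firstDiff {x y : ℤ → A} (h : x ≠ y) :
    ∃ i : ℤ, i.natAbs = firstDiff x y ∧ x i ≠ y i := by
  obtain ⟨i, hi⟩ := Function.ne_iff.1 h
  exact Nat.sInf_mem (s := {m | ∃ i : ℤ, i.natAbs = m ∧ x i ≠ y i}) ⟨_, i, rfl, hi⟩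

variable {d : ℝ}

theorem windowDist_self (x : ℤ → A) : windowDist d x x = 0 := if_pos rfl

theorem windowDist_of_ne {x y : ℤ → A} (h : x ≠ y) :
    windowDist d x y = ((firstDiff x y : ℝ) + 1) ^ (-(1 / d)) := if_neg h

theorem windowDist_pos {x y : ℤ → A} (h : x ≠ y) : 0 < windowDist d x y := by
  rw [windowDist_of_ne h]; positivity

theorem windowDist_nonneg (x y : ℤ → A) : 0 ≤ windowDist d x y := by
  by_cases h : x = y
  · rw [h, windowDist_self]
  · exact (windowDist_pos h).le

theorem windowDist_comm (x y : ℤ → A) : windowDist d x y = windowDist d y x := by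
  by_cases h : x = y
  · rw [h]
  · rw [windowDist_of_ne h, windowDist_of_ne (Ne.symm h)]
    simp only [firstDiff, ne_comm (a := x _)]

theorem windowDist_le_iff (hd : 0 < d) {x y : ℤ → A} (m : ℕ) :
    windowDist d x y ≤ ((m : ℝ) + 1) ^ (-(1 / d)) ↔ ∀ i : ℤ, i.natAbs < m → x i = y i := by
  by_cases h : x = y
  · subst h; simp [windowDist_self]; positivity
  rw [windowDist_of_ne h, Real.rpow_le_rpow_iff_of_neg (by positivity) (by positivity)
    (by rw [neg_lt_zero]; positivity), add_le_add_iff_right, Nat.cast_le]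
  refine ⟨fun hm i hi => eq_of_natAbs_lt_firstDiff (hi.trans_le hm), fun hm => ?_⟩
  obtain ⟨i, hi, hne⟩ := exists_natAbs_eq_firstDiff h
  by_contra! hlt
  exact hne (hm i (by omega))

/-- The strict inequality also excludes a difference at distance exactly `m`, which the non-strict
one allows. -/
theorem windowDist_lt_iff (hd : 0 < d) {x y : ℤ → A} (m : ℕ) :
    windowDist d x y < ((m : ℝ) + 1) ^ (-(1 / d)) ↔ ∀ i : ℤ, i.natAbs ≤ m → x i = y i := by
  by_cases h : x = y
  · subst h; simp [windowDist_self]; positivity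
  rw [windowDist_of_ne h, Real.rpow_lt_rpow_iff_of_neg (by positivity) (by positivity)
    (by rw [neg_lt_zero]; positivity), add_lt_add_iff_right, Nat.cast_lt]
  refine ⟨fun hm i hi => eq_of_natAbs_lt_firstDiff (hi.trans_lt hm), fun hm => ?_⟩
  obtain ⟨i, hi, hne⟩ := exists_natAbs_eq_firstDiff h
  by_contra! hlt
  exact hne (hm i (by omega))

theorem windowDist_triangle (hd : 0 < d) (x y z : ℤ → A) :
    windowDist d x z ≤ windowDist d x y + windowDist d y z := by
  have hxy := windowDist_nonneg (d := d) x y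
  have hyz := windowDist_nonneg (d := d) y z
  by_cases h : x = z
  · rw [h, windowDist_self, ← h]; exact add_nonneg hxy (h ▸ hyz)
  obtain ⟨i, hi, hne⟩ := exists_natAbs_eq_firstDiff h
  rw [windowDist_of_ne h]
  -- Where `x` and `z` first differ, `y` differs from one of them, so one distance on the right is
  -- already at least `windowDist d x z`.
  by_cases hi' : x i = y i
  · have : ¬ windowDist d y z < _ :=
      fun hlt => hne (hi'.trans ((windowDist_lt_iff hd (firstDiff x z)).1 hlt i hi.le))
    linarith
  · have : ¬ windowDist d x y < _ :=
      fun hlt => hi' ((windowDist_lt_iff hd (firstDiff x z)).1 hlt i hi.le)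
    linarith

theorem windowDist_translate_le (hd : 0 < d) (x y : ℤ → A) {c : ℤ} {k : ℕ} (hc : c.natAbs ≤ k) :
    windowDist d (fun i => x (i + c)) (fun i => y (i + c)) ≤
      ((k : ℝ) + 1) ^ (1 / d) * windowDist d x y := by
  by_cases h : (fun i => x (i + c)) = fun i => y (i + c)
  · rw [h, windowDist_self]
    exact mul_nonneg (by positivity) (windowDist_nonneg _ _)
  obtain ⟨i, hi, hne⟩ := exists_natAbs_eq_firstDiff h
  have hxy : x ≠ y := fun e => h (by rw [e])
  rw [windowDist_of_ne h, windowDist_of_ne hxy, ← hi]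
  have hle : firstDiff x y ≤ i.natAbs + k := (firstDiff_le hne).trans (by omega)
  have hle' : ((firstDiff x y : ℝ) + 1) ≤ ((k : ℝ) + 1) * (i.natAbs + 1) := by
    have : firstDiff x y + 1 ≤ (k + 1) * (i.natAbs + 1) := by nlinarith
    exact_mod_cast this
  have h1 := Real.rpow_le_rpow (by positivity) hle' (by positivity : 0 ≤ 1 / d)
  rw [Real.mul_rpow (by positivity) (by positivity)] at h1
  rw [Real.rpow_neg (by positivity), Real.rpow_neg (by positivity), ← div_eq_mul_inv,
    le_div_iff₀ (by positivity), inv_mul_le_iff₀ (by positivity), mul_comm]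
  exact h1

/-- The subshift of `v` with the metric `windowDist d`. -/
def WindowSpace (v : ℕ → A) {d : ℝ} (_ : 0 < d) : Type _ := subshift v

noncomputable instance (v : ℕ → A) (hd : 0 < d) : MetricSpace (WindowSpace v hd) where
  dist x y := windowDist d x.1 y.1
  dist_self x := windowDist_self _
  dist_comm x y := windowDist_comm _ _
  dist_triangle x y z := windowDist_triangle hd _ _ _
  eq_of_dist_eq_zero {x y} h := by
    by_contra hne
    exact (windowDist_pos (d := d) fun e => hne (Subtype.ext e)).ne' h

theorem WindowSpace.dist_def {v : ℕ → A} {hd : 0 < d} (x y : WindowSpace v hd) :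
    dist x y = windowDist d x.1 y.1 := rfl

theorem exists_window_scale_lt (hd : 0 < d) {ε : ℝ} (hε : 0 < ε) :
    ∃ m : ℕ, ((m : ℝ) + 1) ^ (-(1 / d)) < ε := by
  have h : Tendsto (fun m : ℕ => ((m : ℝ) + 1) ^ (-(1 / d))) atTop (𝓝 0) :=
    (tendsto_rpow_neg_atTop (by positivity : 0 < 1 / d)).comp
      (tendsto_atTop_add_const_right _ 1 tendsto_natCast_atTop_atTop)
  exact (h.eventually (gt_mem_nhds hε)).exists

variable [TopologicalSpace A] [DiscreteTopology A]

/-- The metric `windowDist d` induces the product topology. -/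
noncomputable def WindowSpace.homeo (v : ℕ → A) (hd : 0 < d) : WindowSpace v hd ≃ₜ subshift v where
  toFun x := x
  invFun x := x
  left_inv _ := rfl
  right_inv _ := rfl
  continuous_toFun := by
    refine continuous_induced_rng.2 (continuous_pi fun n => ?_)
    refine continuous_iff_continuousAt.2 fun x => ?_
    refine ContinuousAt.congr (f := fun _ => x.1 n) continuousAt_const ?_
    filter_upwards [Metric.ball_mem_nhds x
      (by positivity : 0 < ((n.natAbs : ℝ) + 1) ^ (-(1 / d)))] with y hy
    rw [Metric.mem_ball'] at hy
    exact (windowDist_lt_iff hd n.natAbs).1 hy n le_rfl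
  continuous_invFun := by
    refine continuous_iff_continuousAt.2 fun x => Metric.tendsto_nhds.2 fun ε hε => ?_
    obtain ⟨m, hm⟩ := exists_window_scale_lt hd hε
    have hev : ∀ᶠ y : subshift v in 𝓝 x, ∀ i ∈ Finset.Icc (-(m : ℤ)) m, y.1 i = x.1 i := by
      rw [Filter.eventually_all_finset]
      intro i _
      have hc : Continuous fun y : subshift v => y.1 i :=
        (continuous_apply i).comp continuous_subtype_val
      exact hc.continuousAt.eventually ((isOpen_discrete {x.1 i}).mem_nhds rfl)
    filter_upwards [hev] with y hy
    refine lt_of_le_of_lt ((windowDist_le_iff hd m).2 fun i hi => hy i ?_) hm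
    rw [Finset.mem_Icc]
    omega

theorem isClosed_subshift (v : ℕ → A) : IsClosed (subshift v) := by
  have h : subshift v = ⋂ (n : ℤ) (k : ℕ), (fun (x : ℤ → A) (i : Fin k) => x (n + (i : ℕ))) ⁻¹'
      {w | ∃ m : ℕ, ∀ i : Fin k, w i = v (m + i)} := by
    ext x
    simp [subshift, Fin.forall_iff]
  rw [h]
  refine isClosed_iInter fun n => isClosed_iInter fun k => ?_
  exact (isClosed_discrete _).preimage (continuous_pi fun i => continuous_apply _)

instance [Finite A] (v : ℕ → A) (hd : 0 < d) : CompactSpace (WindowSpace v hd) := by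
  have : CompactSpace (subshift v) := isCompact_iff_compactSpace.1 (isClosed_subshift v).isCompact
  exact (WindowSpace.homeo v hd).symm.compactSpace

/-- The shift on `WindowSpace v hd`. -/
noncomputable def WindowSpace.shift (v : ℕ → A) (hd : 0 < d) :
    WindowSpace v hd ≃ₜ WindowSpace v hd :=
  ((WindowSpace.homeo v hd).trans (BiLipGrowth.shift v)).trans (WindowSpace.homeo v hd).symm

theorem WindowSpace.shift_zpow_apply (v : ℕ → A) (hd : 0 < d) (k : ℤ) (x : WindowSpace v hd)
    (i : ℤ) : ((WindowSpace.shift v hd ^ k) x).1 i = x.1 (i + k) := by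
  induction k generalizing i with
  | zero => simp
  | succ k ih =>
    rw [add_comm (k : ℤ) 1, zpow_add, zpow_one]
    change ((WindowSpace.shift v hd ^ (k : ℤ)) x).1 (i + 1) = _
    rw [ih, add_assoc]
  | pred k ih =>
    rw [sub_eq_add_neg, add_comm (-(k : ℤ)) (-1), zpow_add, zpow_neg_one]
    change ((WindowSpace.shift v hd ^ (-(k : ℤ))) x).1 (i + -1) = _
    rw [ih, add_assoc]

theorem WindowSpace.shift_pow_apply (v : ℕ → A) (hd : 0 < d) (k : ℕ) (x : WindowSpace v hd)
    (i : ℤ) : ((WindowSpace.shift v hd ^ k) x).1 i = x.1 (i + k) := by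
  rw [← WindowSpace.shift_zpow_apply, zpow_natCast]

theorem WindowSpace.lipschitzWith_shift_zpow (v : ℕ → A) (hd : 0 < d) {c : ℤ} {k : ℕ}
    (hc : c.natAbs ≤ k) :
    LipschitzWith (((k : ℝ≥0) + 1) ^ (1 / d)) (WindowSpace.shift v hd ^ c) := by
  refine LipschitzWith.of_dist_le_mul fun x y => ?_
  have h : ∀ x : WindowSpace v hd,
      ((WindowSpace.shift v hd ^ c) x).1 = fun i => x.1 (i + c) :=
    fun x => funext fun i => WindowSpace.shift_zpow_apply v hd c x i
  rw [WindowSpace.dist_def, WindowSpace.dist_def, h, h]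
  exact_mod_cast windowDist_translate_le hd x.1 y.1 hc

end WindowDist

/-! ### Box dimension from two-sided bounds on covering numbers -/

theorem coverNum_le_of_isNet {X : Type*} [MetricSpace X] {δ ε : ℝ} (h : δ < ε / 2) {s : Finset X}
    (hs : IsNet δ s) : coverNum (Set.univ : Set X) ε ≤ s.card := by
  refine Nat.sInf_le ⟨s, rfl, fun x _ => ?_⟩
  obtain ⟨y, hy, hxy⟩ := hs x
  exact Set.mem_iUnion₂.2 ⟨y, hy, hxy.trans_lt h⟩

theorem tendsto_log_div_log_of_bounds {N : ℝ → ℝ} {d c C : ℝ} (hc : 0 < c)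
    (h : ∀ ε, 0 < ε → ε < 1 → c * ε ^ (-d) ≤ N ε ∧ N ε ≤ C * ε ^ (-d)) :
    Tendsto (fun ε => Real.log (N ε) / Real.log (1 / ε)) (𝓝[>] 0) (𝓝 d) := by
  have hL : Tendsto (fun ε : ℝ => Real.log (1 / ε)) (𝓝[>] 0) atTop := by
    simp only [one_div]
    exact Real.tendsto_log_atTop.comp tendsto_inv_nhdsGT_zero
  have hlim : ∀ a : ℝ,
      Tendsto (fun ε : ℝ => Real.log a / Real.log (1 / ε) + d) (𝓝[>] 0) (𝓝 d) := fun a => by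
    simpa using (hL.const_div_atTop (Real.log a)).add_const d
  have hev : ∀ᶠ ε : ℝ in 𝓝[>] 0, 0 < ε ∧ ε < 1 :=
    (eventually_mem_nhdsWithin.and (eventually_nhdsWithin_of_eventually_nhds
      (gt_mem_nhds one_pos))).mono fun ε hε => hε
  have hlog : ∀ a ε : ℝ, 0 < a → 0 < ε → ε < 1 →
      Real.log a / Real.log (1 / ε) + d = Real.log (a * ε ^ (-d)) / Real.log (1 / ε) := by
    intro a ε ha h0 h1
    have : Real.log ε ≠ 0 := (Real.log_neg h0 h1).ne
    rw [Real.log_mul ha.ne' (by positivity), Real.log_rpow h0, one_div, Real.log_inv]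
    field_simp
    ring
  refine tendsto_of_tendsto_of_tendsto_of_le_of_le' (hlim c) (hlim C) ?_ ?_
  · filter_upwards [hev] with ε hε
    rw [hlog c ε hc hε.1 hε.2]
    have := hε.1
    refine div_le_div_of_nonneg_right (Real.log_le_log (by positivity) (h ε hε.1 hε.2).1) ?_
    exact Real.log_nonneg (by rw [le_div_iff₀ hε.1]; linarith [hε.2])
  · filter_upwards [hev] with ε hε
    have h0 := hε.1
    obtain ⟨h1, h2⟩ := h ε hε.1 hε.2
    have hN : 0 < N ε := lt_of_lt_of_le (by positivity) h1
    have hC : 0 < C := pos_of_mul_pos_left (hN.trans_le h2) (by positivity)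
    rw [hlog C ε hC hε.1 hε.2]
    refine div_le_div_of_nonneg_right (Real.log_le_log hN h2) ?_
    exact Real.log_nonneg (by rw [le_div_iff₀ hε.1]; linarith [hε.2])

theorem upperBoxDim_eq_of_bounds {X : Type*} [MetricSpace X] {d κ c : ℝ} (hd : 0 < d)
    (hc : 0 < c)
    (hnet : ∀ δ : ℝ, 0 < δ → ∃ s : Finset X, IsNet δ s ∧ (s.card : ℝ) ≤ max 1 (κ * δ ^ (-d)))
    (hcover : ∀ ε : ℝ, 0 < ε → c * ε ^ (-d) ≤ coverNum (Set.univ : Set X) ε) :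
    upperBoxDim (Set.univ : Set X) = (d : EReal) := by
  refine Tendsto.limsup_eq ((continuous_coe_real_ereal.tendsto d).comp
    (tendsto_log_div_log_of_bounds (N := fun ε => (coverNum (Set.univ : Set X) ε : ℝ))
      (C := max 1 (κ * (1 / 4) ^ (-d))) hc fun ε h0 h1 => ⟨hcover ε h0, ?_⟩))
  -- The radius `ε / 4` is strictly below `ε / 2`, as open balls require.
  obtain ⟨s, hs, hcard⟩ := hnet (ε * (1 / 4)) (by positivity)
  refine (Nat.cast_le.2 (coverNum_le_of_isNet (by linarith) hs)).trans (hcard.trans ?_)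
  rw [Real.mul_rpow h0.le (by norm_num)]
  have h2 : 1 ≤ ε ^ (-d) := Real.one_le_rpow_of_pos_of_le_one_of_nonpos h0 h1.le (by linarith)
  rw [max_mul_of_nonneg _ _ (by positivity)]
  exact max_le_max (by linarith) (by rw [mul_comm (ε ^ (-d)), mul_assoc])

/-! ### Words of the Rudin-Shapiro shift -/

section Words

variable {d : ℝ} (hd : 0 < d)

theorem exists_windowSpace_extension :
    ∃ x : WindowSpace rudinShapiro hd, ∀ i : ℕ, x.1 i = rudinShapiro i := by
  obtain ⟨x, hx, hx'⟩ := exists_extension_rudinShapiro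
  exact ⟨⟨x, hx⟩, hx'⟩

theorem nonempty_windowSpace_rudinShapiro : Nonempty (WindowSpace rudinShapiro hd) :=
  (exists_windowSpace_extension hd).nonempty

/-- The Rudin-Shapiro shift has at most linearly many words. -/
theorem exists_window_net (m : ℕ) : ∃ s : Finset (WindowSpace rudinShapiro hd),
    s.card ≤ 64 * (m + 1) ∧ ∀ x : WindowSpace rudinShapiro hd, ∃ y ∈ s,
      ∀ i : ℤ, i.natAbs ≤ m → x.1 i = y.1 i := by
  classical
  have := nonempty_windowSpace_rudinShapiro hd
  obtain ⟨k, hk, hk'⟩ : ∃ k, 2 * m + 1 ≤ 2 ^ k ∧ 2 ^ k ≤ 4 * (m + 1) := by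
    refine ⟨Nat.log 2 (2 * m + 1) + 1, (Nat.lt_pow_succ_log_self one_lt_two _).le, ?_⟩
    have := Nat.pow_log_le_self 2 (show 2 * m + 1 ≠ 0 by omega)
    rw [pow_succ]
    omega
  obtain ⟨code, hcode⟩ := exists_rudinShapiro_code k
  choose pos hpos using fun x : WindowSpace rudinShapiro hd => x.2 (-m) (2 * m + 1)
  -- One point is kept per code value; values not attained yield arbitrary points, which are
  -- harmless.
  let F := Function.invFun fun x => code (pos x)
  refine ⟨Finset.univ.image F, ?_, fun x => ⟨F (code (pos x)),
    Finset.mem_image_of_mem _ (Finset.mem_univ _), fun i hi => ?_⟩⟩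
  · refine Finset.card_image_le.trans ?_
    simp only [Finset.card_univ, Fintype.card_prod, Fintype.card_fin, Fintype.card_units_int]
    omega
  · have hF : code (pos (F (code (pos x)))) = code (pos x) :=
      Function.invFun_eq (f := fun x => code (pos x)) ⟨x, rfl⟩
    obtain ⟨j, hj⟩ := Int.eq_ofNat_of_zero_le (show 0 ≤ i + m by omega)
    obtain rfl : i = -m + (j : ℤ) := by omega
    rw [hpos _ j (by omega), hpos _ j (by omega)]
    exact hcode _ _ hF.symm j (by omega)

theorem infinite_windowSpace_rudinShapiro : Infinite (WindowSpace rudinShapiro hd) := by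
  obtain ⟨x, hx⟩ := exists_windowSpace_extension hd
  refine Infinite.of_injective (fun n : ℕ => (WindowSpace.shift rudinShapiro hd ^ n) x)
    (Function.Injective.of_lt_imp_ne fun a b hab h => ?_)
  refine rudinShapiro_not_periodic a (b - a) (by omega) fun n hn => ?_
  have h1 : ((WindowSpace.shift rudinShapiro hd ^ a) x).1 (n - a) =
      ((WindowSpace.shift rudinShapiro hd ^ b) x).1 (n - a) :=
    congrArg (fun z : WindowSpace rudinShapiro hd => z.1 (n - a)) h
  rw [WindowSpace.shift_pow_apply, WindowSpace.shift_pow_apply] at h1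
  rw [← hx, ← hx]
  convert h1.symm using 2 <;> omega

/-- There are points whose closest difference is exactly at distance `n` from the origin. -/
theorem exists_firstDiff_eq (n : ℕ) : ∃ x y : WindowSpace rudinShapiro hd,
    (∀ i : ℤ, i.natAbs < n → x.1 i = y.1 i) ∧ ∃ i : ℤ, i.natAbs = n ∧ x.1 i ≠ y.1 i := by
  have := infinite_windowSpace_rudinShapiro hd
  obtain ⟨s, -, hs⟩ := exists_window_net hd n
  choose F hF hF' using hs
  obtain ⟨x, y, hne, hxy⟩ := Finite.exists_ne_map_eq_of_infinite fun x => (⟨F x, hF x⟩ : s)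
  have hFxy : F x = F y := congrArg Subtype.val hxy
  have hagree : ∀ i : ℤ, i.natAbs ≤ n → x.1 i = y.1 i := fun i hi => by
    rw [hF' x i hi, hF' y i hi, hFxy]
  obtain ⟨i, hi, hdiff⟩ := exists_natAbs_eq_firstDiff fun e => hne (Subtype.ext e)
  have hlt : n < i.natAbs := by
    by_contra! h
    exact hdiff (hagree i h)
  -- Two distinct points share the window of radius `n`. Their closest difference, at `i`, is
  -- shifted to `j = ±n` with the sign of `i`, so that the positions closer to the origin come from
  -- inside the zone of agreement.
  obtain ⟨j, hj, hj'⟩ : ∃ j : ℤ, j.natAbs = n ∧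
      ∀ a : ℤ, a.natAbs < n → (a + (i - j)).natAbs < i.natAbs := by
    rcases le_total 0 i with h | h
    · exact ⟨n, by omega, fun a ha => by omega⟩
    · exact ⟨-n, by omega, fun a ha => by omega⟩
  refine ⟨(WindowSpace.shift rudinShapiro hd ^ (i - j)) x,
    (WindowSpace.shift rudinShapiro hd ^ (i - j)) y, fun a ha => ?_, j, hj, ?_⟩
  · rw [WindowSpace.shift_zpow_apply, WindowSpace.shift_zpow_apply]
    exact eq_of_natAbs_lt_firstDiff (by rw [← hi]; exact hj' a ha)
  · rwa [WindowSpace.shift_zpow_apply, WindowSpace.shift_zpow_apply, add_sub_cancel]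

/-- The Rudin-Shapiro shift has at least linearly many words. -/
theorem exists_window_separated (m : ℕ) : ∃ s : Finset (WindowSpace rudinShapiro hd),
    s.card = m + 1 ∧ ∀ x ∈ s, ∀ y ∈ s, (∀ i : ℤ, i.natAbs < m → x.1 i = y.1 i) → x = y := by
  classical
  induction m with
  | zero =>
    obtain ⟨x⟩ := nonempty_windowSpace_rudinShapiro hd
    exact ⟨{x}, by simp, by simp⟩
  | succ m ih =>
    obtain ⟨s, hcard, hs⟩ := ih
    obtain ⟨x, y, hxy, i, hi, hne⟩ := exists_firstDiff_eq hd m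
    -- `x` and `y` agree up to distance `m - 1`, so `s` has at most one point matching them there.
    -- That point cannot match both at distance `m`, so one of the two is new.
    obtain ⟨z, hz⟩ : ∃ z : WindowSpace rudinShapiro hd,
        ∀ w ∈ s, ¬ ∀ i : ℤ, i.natAbs < m + 1 → z.1 i = w.1 i := by
      by_contra! hcon
      obtain ⟨w, hw, hxw⟩ := hcon x
      obtain ⟨w', hw', hyw⟩ := hcon y
      obtain rfl := hs w hw w' hw' fun j hj => by
        rw [← hxw j (by omega), ← hyw j (by omega), hxy j hj]
      exact hne ((hxw i (by omega)).trans (hyw i (by omega)).symm)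
    have hzs : z ∉ s := fun h => hz z h fun _ _ => rfl
    refine ⟨insert z s, by rw [Finset.card_insert_of_notMem hzs, hcard], ?_⟩
    intro a ha b hb hab
    rcases Finset.mem_insert.1 ha with ha' | ha' <;> rcases Finset.mem_insert.1 hb with hb' | hb'
    · rw [ha', hb']
    · exact absurd (ha' ▸ hab) (hz b hb')
    · exact absurd (fun i hi => (hb' ▸ hab i hi).symm) (hz a ha')
    · exact hs a ha' b hb' fun i hi => hab i (by omega)

theorem rpow_neg_inv_le_iff {d : ℝ} (hd : 0 < d) {a δ : ℝ} (ha : 0 < a) (hδ : 0 < δ) :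
    a ^ (-(1 / d)) ≤ δ ↔ δ ^ (-d) ≤ a := by
  have h := Real.rpow_inv_le_iff_of_neg ha hδ (neg_lt_zero.2 hd)
  rwa [inv_neg, ← one_div] at h

theorem exists_isNet_windowSpace_rudinShapiro (δ : ℝ) (hδ : 0 < δ) :
    ∃ s : Finset (WindowSpace rudinShapiro hd), IsNet δ s ∧
      (s.card : ℝ) ≤ max 1 (128 * δ ^ (-d)) := by
  rcases le_or_gt 1 δ with h1 | h1
  · obtain ⟨x⟩ := nonempty_windowSpace_rudinShapiro hd
    refine ⟨{x}, fun y => ⟨x, by simp, ?_⟩, by simp⟩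
    have := (windowDist_le_iff hd (x := y.1) (y := x.1) 0).2 fun i hi => by omega
    simp only [Nat.cast_zero, zero_add, Real.one_rpow] at this
    exact this.trans h1
  · obtain ⟨s, hcard, hs⟩ := exists_window_net hd ⌊δ ^ (-d)⌋₊
    have h2 : 1 ≤ δ ^ (-d) := Real.one_le_rpow_of_pos_of_le_one_of_nonpos hδ h1.le (by linarith)
    refine ⟨s, fun x => ?_, le_max_of_le_right ?_⟩
    · obtain ⟨y, hy, hxy⟩ := hs x
      refine ⟨y, hy, ((windowDist_lt_iff hd _).2 hxy).le.trans ?_⟩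
      exact (rpow_neg_inv_le_iff hd (by positivity) hδ).2 (Nat.lt_floor_add_one _).le
    · have h3 : (s.card : ℝ) ≤ 64 * ((⌊δ ^ (-d)⌋₊ : ℝ) + 1) := by exact_mod_cast hcard
      have := Nat.floor_le (show 0 ≤ δ ^ (-d) by positivity)
      linarith

theorem coverNum_windowSpace_rudinShapiro_ge (ε : ℝ) (hε : 0 < ε) :
    (1 / 2) ^ (-d) * ε ^ (-d) ≤
      coverNum (Set.univ : Set (WindowSpace rudinShapiro hd)) ε := by
  rw [← Real.mul_rpow (by norm_num) hε.le, show 1 / 2 * ε = ε / 2 by ring]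
  have hε2 : 0 < ε / 2 := by positivity
  generalize hm : ⌊(ε / 2) ^ (-d)⌋₊ = m
  have hlt : (ε / 2) ^ (-d) < m + 1 := by rw [← hm]; exact Nat.lt_floor_add_one _
  -- Nonemptiness ensures that the infimum is attained by an actual cover and is not the default
  -- value `0`.
  have hne : {n : ℕ | ∃ s : Finset (WindowSpace rudinShapiro hd), s.card = n ∧
      Set.univ ⊆ ⋃ x ∈ s, Metric.ball x (ε / 2)}.Nonempty := by
    obtain ⟨s, hs, -⟩ := exists_isNet_windowSpace_rudinShapiro hd (ε / 4) (by positivity)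
    refine ⟨_, s, rfl, fun x _ => ?_⟩
    obtain ⟨y, hy, hxy⟩ := hs x
    exact Set.mem_iUnion₂.2 ⟨y, hy, hxy.trans_lt (by linarith)⟩
  obtain ⟨s, hs, hcov⟩ := Nat.sInf_mem hne
  obtain ⟨t, ht, hsep⟩ := exists_window_separated hd m
  choose F hF hF' using fun x => Set.mem_iUnion₂.1 (hcov (Set.mem_univ x))
  have hle : t.card ≤ s.card := by
    refine Finset.card_le_card_of_injOn F (fun x _ => hF x) fun x hx y hy hxy => ?_
    refine hsep x hx y hy ?_
    rcases Nat.eq_zero_or_pos m with rfl | hmpos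
    · intro i hi; omega
    have hmle : (m : ℝ) ≤ (ε / 2) ^ (-d) := by
      rw [← hm]; exact Nat.floor_le (by positivity)
    -- A ball of radius `ε / 2` now fixes all coordinates up to distance `m - 1`, so it contains at
    -- most one of the `m + 1` separated points.
    have hscale : ε / 2 ≤ ((m - 1 : ℕ) + 1 : ℝ) ^ (-(1 / d)) := by
      have h := Real.le_rpow_inv_iff_of_neg hε2 (show (0 : ℝ) < m by exact_mod_cast hmpos)
        (neg_lt_zero.2 hd)
      rw [inv_neg, ← one_div] at h
      have hcast : ((m - 1 : ℕ) + 1 : ℝ) = m := by exact_mod_cast Nat.succ_pred_eq_of_pos hmpos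
      rw [hcast]
      exact h.2 hmle
    have hagree : ∀ z : WindowSpace rudinShapiro hd, ∀ i : ℤ, i.natAbs < m →
        z.1 i = (F z).1 i := fun z i hi =>
      (windowDist_lt_iff hd (m - 1)).1 (lt_of_lt_of_le (hF' z) hscale) i (by omega)
    intro i hi
    rw [hagree x i hi, hagree y i hi, hxy]
  have h1 : ((m : ℝ) + 1) ≤ s.card := by
    rw [ht] at hle; exact_mod_cast hle
  have h2 : coverNum (Set.univ : Set (WindowSpace rudinShapiro hd)) ε = s.card := hs.symm
  rw [h2]
  linarith

/-! ### Growth -/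

theorem rpow_le_of_lipschitzWith {c : ℤ} {n : ℕ} {x y : WindowSpace rudinShapiro hd}
    (hxy : ∀ i : ℤ, i.natAbs < n → x.1 i = y.1 i) (hne : x.1 c ≠ y.1 c) {K : ℝ≥0}
    (hK : LipschitzWith K (WindowSpace.shift rudinShapiro hd ^ c)) :
    ((n : ℝ) + 1) ^ (1 / d) ≤ K := by
  have h1 := hK.dist_le_mul x y
  have h2 := (windowDist_le_iff hd n).2 hxy
  have h3 : (1 : ℝ) ≤ dist ((WindowSpace.shift rudinShapiro hd ^ c) x)
      ((WindowSpace.shift rudinShapiro hd ^ c) y) := by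
    by_contra! hlt
    have := (windowDist_lt_iff hd (x := ((WindowSpace.shift rudinShapiro hd ^ c) x).1)
      (y := ((WindowSpace.shift rudinShapiro hd ^ c) y).1) 0).1 (hlt.trans_eq (by simp)) 0 le_rfl
    rw [WindowSpace.shift_zpow_apply, WindowSpace.shift_zpow_apply, zero_add] at this
    exact hne this
  rw [WindowSpace.dist_def x y] at h1
  have h4 := h3.trans (h1.trans (mul_le_mul_of_nonneg_left h2 K.2))
  rw [Real.rpow_neg (by positivity), ← div_eq_mul_inv,
    le_div_iff₀ (by positivity), one_mul] at h4
  exact h4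

theorem WindowSpace.growth_shift_pow_le (n : ℕ) :
    growth (WindowSpace.shift rudinShapiro hd ^ n) ≤ ((n : ℝ≥0) + 1) ^ (1 / d) := by
  refine max_le (csInf_le' ?_) (csInf_le' ?_)
  · have := WindowSpace.lipschitzWith_shift_zpow rudinShapiro hd (c := n) (k := n) (by simp)
    rwa [zpow_natCast] at this
  · have := WindowSpace.lipschitzWith_shift_zpow rudinShapiro hd (c := -n) (k := n) (by simp)
    rwa [zpow_neg, zpow_natCast] at this

theorem WindowSpace.le_growth_shift_pow (n : ℕ) :
    ((n : ℝ≥0) + 1) ^ (1 / d) ≤ growth (WindowSpace.shift rudinShapiro hd ^ n) := by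
  obtain ⟨x, y, hxy, i, hi, hne⟩ := exists_firstDiff_eq hd n
  -- The side on which the difference lies decides whether the power or its inverse expands by the
  -- full factor; `growth` takes the maximum of the two.
  rcases Int.natAbs_eq i with h | h <;> rw [hi] at h <;> subst h
  · refine le_max_of_le_left (le_csInf ⟨((n : ℝ≥0) + 1) ^ (1 / d), ?_⟩ fun K hK => ?_)
    · have := WindowSpace.lipschitzWith_shift_zpow rudinShapiro hd (c := n) (k := n) (by simp)
      rwa [zpow_natCast] at this
    · have := rpow_le_of_lipschitzWith hd hxy hne (K := K) (by rwa [zpow_natCast])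
      exact_mod_cast this
  · refine le_max_of_le_right (le_csInf ⟨((n : ℝ≥0) + 1) ^ (1 / d), ?_⟩ fun K hK => ?_)
    · have := WindowSpace.lipschitzWith_shift_zpow rudinShapiro hd (c := -n) (k := n) (by simp)
      rwa [zpow_neg, zpow_natCast] at this
    · have := rpow_le_of_lipschitzWith hd hxy hne (K := K) (by rwa [zpow_neg, zpow_natCast])
      exact_mod_cast this

theorem WindowSpace.growthHat_shift (n : ℕ) (hn : 1 ≤ n) :
    growthHat (WindowSpace.shift rudinShapiro hd) n = ((n : ℝ≥0) + 1) ^ (1 / d) := by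
  refine le_antisymm (Finset.sup_le fun i hi => ?_) ?_
  · refine (WindowSpace.growth_shift_pow_le hd i).trans (NNReal.rpow_le_rpow ?_ (by positivity))
    have : (i : ℝ≥0) ≤ n := by exact_mod_cast (Finset.mem_Icc.1 hi).2
    gcongr
  · exact (WindowSpace.le_growth_shift_pow hd n).trans
      (Finset.le_sup (f := fun i => growth (WindowSpace.shift rudinShapiro hd ^ i))
        (Finset.mem_Icc.2 ⟨hn, le_rfl⟩))

end Words

/-! ### The invariant measure -/

section InvariantMeasure

variable {d : ℝ} (hd : 0 < d)

/-- Every prefix of the Rudin-Shapiro sequence occurs in every point, within a bounded distance. -/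
theorem exists_shift_eq_prefix (k : ℕ) (x : WindowSpace rudinShapiro hd) :
    ∃ s : ℕ, s < 16 * 2 ^ k ∧ ∀ i < 2 ^ k, x.1 ((s : ℤ) + (i : ℕ)) = rudinShapiro i := by
  obtain ⟨p, hp⟩ := x.2 0 (16 * 2 ^ k + 2 ^ k)
  obtain ⟨n, hn1, hn2, hn⟩ := rudinShapiro_recurrent k p
  refine ⟨n - p, by omega, fun i hi => ?_⟩
  have h := hp (n - p + i) (by omega)
  rw [zero_add, show p + (n - p + i) = n + i by omega, hn i hi] at h
  exact_mod_cast h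

/-- The coordinate at the origin as a real function. -/
def WindowSpace.origin (x : WindowSpace rudinShapiro hd) : ℝ := ((x.1 0 : ℤ) : ℝ)

theorem WindowSpace.lipschitzWith_origin : LipschitzWith 2 (WindowSpace.origin hd) := by
  refine LipschitzWith.of_dist_le_mul fun x y => ?_
  by_cases h : x.1 0 = y.1 0
  · rw [WindowSpace.origin, WindowSpace.origin, h, dist_self]
    positivity
  · have h1 : (1 : ℝ) ≤ dist x y := by
      by_contra! hlt
      exact h ((windowDist_lt_iff hd (x := x.1) (y := y.1) 0).1 (hlt.trans_eq (by simp)) 0 le_rfl)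
    have h2 : dist (WindowSpace.origin hd x) (WindowSpace.origin hd y) ≤ 2 := by
      simp only [WindowSpace.origin, Real.dist_eq]
      rcases Int.units_eq_one_or (x.1 0) with h | h <;>
      rcases Int.units_eq_one_or (y.1 0) with h' | h' <;> rw [h, h'] <;> norm_num
    have h3 : ((2 : ℝ≥0) : ℝ) = 2 := rfl
    rw [h3]
    linarith

variable [MeasurableSpace (WindowSpace rudinShapiro hd)] [BorelSpace (WindowSpace rudinShapiro hd)]

/-- Bounded gaps let finitely many preimages of a nonempty open set cover the space. By invariance a
null open set would make them all null. -/
theorem isOpenPosMeasure_of_measurePreserving_shift (μ : Measure (WindowSpace rudinShapiro hd))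
    [IsProbabilityMeasure μ] (hμ : MeasurePreserving (WindowSpace.shift rudinShapiro hd) μ μ) :
    μ.IsOpenPosMeasure := by
  refine ⟨fun U hU ⟨x, hx⟩ hzero => ?_⟩
  obtain ⟨ε, hε, hball⟩ := Metric.isOpen_iff.1 hU x hx
  obtain ⟨l, hl⟩ := exists_window_scale_lt hd hε
  obtain ⟨m, hm⟩ := x.2 (-l) (2 * l + 1)
  -- The central word of `x` lies in the prefix of length `2 ^ k`, which occurs in `y` at some `s`.
  -- Shifting `y` by `s + m + l` centers that word.
  obtain ⟨k, hk⟩ : ∃ k, m + 2 * l + 1 ≤ 2 ^ k := ⟨_, Nat.lt_two_pow_self.le⟩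
  have hcover : (Set.univ : Set (WindowSpace rudinShapiro hd)) ⊆
      ⋃ s : Fin (16 * 2 ^ k), (WindowSpace.shift rudinShapiro hd ^ ((s : ℕ) + m + l)) ⁻¹' U := by
    intro y _
    obtain ⟨s, hs, hy⟩ := exists_shift_eq_prefix hd k y
    refine Set.mem_iUnion.2 ⟨⟨s, hs⟩, hball ?_⟩
    rw [Metric.mem_ball]
    refine lt_of_le_of_lt ((windowDist_le_iff hd l).2 fun i hi => ?_) hl
    obtain ⟨j, hj⟩ := Int.eq_ofNat_of_zero_le (show 0 ≤ i + l by omega)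
    obtain rfl : i = -l + (j : ℤ) := by omega
    rw [WindowSpace.shift_pow_apply, hm j (by omega), ← hy (m + j) (by omega)]
    exact congrArg y.1 (by push_cast; ring)
  have hnull : ∀ n : ℕ, μ ((WindowSpace.shift rudinShapiro hd ^ n) ⁻¹' U) = 0 := fun n => by
    have hpow : MeasurePreserving (WindowSpace.shift rudinShapiro hd ^ n) μ μ := by
      have hcoe : ⇑(WindowSpace.shift rudinShapiro hd ^ n) =
          (WindowSpace.shift rudinShapiro hd)^[n] := by
        induction n with
        | zero => rfl
        | succ n ih =>
          rw [pow_succ, Function.iterate_succ, ← ih]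
          rfl
      rw [hcoe]
      exact hμ.iterate n
    rw [hpow.measure_preimage hU.measurableSet.nullMeasurableSet, hzero]
  have h0 : μ Set.univ = 0 :=
    measure_mono_null hcover (measure_iUnion_null fun s => hnull _)
  rw [measure_univ] at h0
  exact one_ne_zero h0

/-- There is an invariant probability measure for which the coordinates are orthonormal and
centered. -/
theorem exists_measure_windowSpace_rudinShapiro :
    ∃ μ : Measure (WindowSpace rudinShapiro hd), IsProbabilityMeasure μ ∧
      MeasurePreserving (WindowSpace.shift rudinShapiro hd) μ μ ∧
      ∫ x, WindowSpace.origin hd x ∂μ = 0 ∧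
      ∀ k : ℕ, 1 ≤ k → correlation μ (WindowSpace.shift rudinShapiro hd)
        (WindowSpace.origin hd) k = 0 := by
  obtain ⟨x, hx⟩ := exists_windowSpace_extension hd
  have hpow : Tendsto (fun k : ℕ => (2 : ℝ) ^ k) atTop atTop :=
    tendsto_pow_atTop_atTop_of_one_lt one_lt_two
  obtain ⟨μ, hprob, hμ, hlim⟩ := exists_invariant_measure_of_birkhoff
    (WindowSpace.shift rudinShapiro hd) x
    (N := fun k => 2 ^ k) (tendsto_pow_atTop_atTop_of_one_lt one_lt_two) (fun k => by positivity)
  have hcont := (WindowSpace.lipschitzWith_origin hd).continuous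
  refine ⟨μ, hprob, hμ, hlim _ hcont _ ?_, fun j hj => hlim _ ?_ _ ?_⟩
  · have h1 : Tendsto (fun k : ℕ => √2 / √((2 : ℝ) ^ k)) atTop (𝓝 0) :=
      tendsto_const_nhds.div_atTop (Real.tendsto_sqrt_atTop.comp hpow)
    refine squeeze_zero_norm (fun k => ?_) h1
    have hsum : ∑ n ∈ Finset.range (2 ^ k), WindowSpace.origin hd
        ((WindowSpace.shift rudinShapiro hd ^ n) x) =
        ((∑ n ∈ Finset.range (2 ^ k), (rudinShapiro n : ℤ) : ℤ) : ℝ) := by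
      simp only [WindowSpace.origin, WindowSpace.shift_pow_apply, zero_add, hx, Int.cast_sum]
    rw [hsum]
    have hsq := sq_sum_rudinShapiro k
    generalize (∑ n ∈ Finset.range (2 ^ k), (rudinShapiro n : ℤ)) = S at *
    have hS : (S : ℝ) ^ 2 ≤ 2 * 2 ^ k := by
      have : S ^ 2 ≤ 2 * 2 ^ k := hsq ▸ le_add_of_nonneg_right (sq_nonneg _)
      exact_mod_cast this
    have hS' : |(S : ℝ)| ≤ √2 * √((2 : ℝ) ^ k) := by
      rw [← Real.sqrt_mul (by norm_num)]
      exact Real.abs_le_sqrt hS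
    rw [norm_div, Real.norm_eq_abs, Real.norm_natCast, Nat.cast_pow, Nat.cast_ofNat,
      div_le_div_iff₀ (by positivity) (by positivity)]
    have hmul : √((2 : ℝ) ^ k) * √((2 : ℝ) ^ k) = 2 ^ k := Real.mul_self_sqrt (by positivity)
    calc |(S : ℝ)| * √((2 : ℝ) ^ k) ≤ √2 * √((2 : ℝ) ^ k) * √((2 : ℝ) ^ k) := by gcongr
      _ = √2 * 2 ^ k := by rw [mul_assoc, hmul]
  · exact (hcont.comp (WindowSpace.shift rudinShapiro hd ^ (j : ℤ)).continuous).mul hcont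
  · obtain ⟨⟨B, hB⟩, -⟩ := corrSum_bounded j hj
    have h1 : Tendsto (fun k : ℕ => (B : ℝ) / (2 : ℝ) ^ k) atTop (𝓝 0) :=
      tendsto_const_nhds.div_atTop hpow
    refine squeeze_zero_norm (fun k => ?_) h1
    have hsum : ∑ n ∈ Finset.range (2 ^ k), WindowSpace.origin hd
        ((WindowSpace.shift rudinShapiro hd ^ (j : ℤ))
          ((WindowSpace.shift rudinShapiro hd ^ n) x)) * WindowSpace.origin hd
          ((WindowSpace.shift rudinShapiro hd ^ n) x) = (corrSum k j : ℝ) := by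
      rw [corrSum, Int.cast_sum]
      refine Finset.sum_congr rfl fun n _ => ?_
      simp only [WindowSpace.origin, WindowSpace.shift_zpow_apply, WindowSpace.shift_pow_apply,
        zero_add, hx]
      rw [← Nat.cast_add, hx, Int.cast_mul, mul_comm, add_comm j n]
    rw [hsum, norm_div, Real.norm_eq_abs, Real.norm_natCast, Nat.cast_pow, Nat.cast_ofNat]
    refine div_le_div_of_nonneg_right ?_ (by positivity)
    exact_mod_cast hB k

end InvariantMeasure

theorem measurePreserving_homeomorph_zpow {X : Type*} [MetricSpace X] [MeasurableSpace X]
    [BorelSpace X] {μ : Measure X} {φ : X ≃ₜ X} (h : MeasurePreserving φ μ μ) (k : ℤ) :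
    MeasurePreserving (φ ^ k) μ μ := by
  induction k with
  | zero => exact MeasurePreserving.id μ
  | succ k ih =>
    rw [zpow_add_one]
    exact ih.comp h
  | pred k ih =>
    rw [zpow_sub_one]
    exact ih.comp (h.symm φ.toMeasurableEquiv)

/-- Substituting `φ ^ k x` for `x` preserves the integral and swaps the two factors, so positive `k`
suffice. -/
theorem correlation_neg {X : Type*} [MetricSpace X] [MeasurableSpace X] [BorelSpace X]
    {μ : Measure X} {φ : X ≃ₜ X} (h : MeasurePreserving φ μ μ) (f : X → ℝ) (k : ℤ) :
    correlation μ φ f (-k) = correlation μ φ f k := by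
  rw [correlation, correlation,
    ← (measurePreserving_homeomorph_zpow h k).integral_comp (φ ^ k).measurableEmbedding]
  refine integral_congr_ae (Eventually.of_forall fun x => ?_)
  have : (φ ^ (-k)) ((φ ^ k) x) = x := by
    rw [zpow_neg]
    exact (φ ^ k).symm_apply_apply x
  simp only [this, mul_comm]

end BiLipGrowth

theorem mainTheorem4 (d : ℝ) (hd : 0 < d) :
    ∃ (X : Type) (_ : MetricSpace X) (_ : CompactSpace X) (_ : MeasurableSpace X)
      (_ : BorelSpace X) (μ : MeasureTheory.Measure X) (φ : X ≃ₜ X),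
      -- `(X, ρ, μ)` is a compact metric space with a Borel probability measure of full support
      MeasureTheory.IsProbabilityMeasure μ ∧ μ.IsOpenPosMeasure ∧
      -- `φ` is a bi-Lipschitz homeomorphism preserving `μ`
      BiLipGrowth.IsBiLipschitz φ ∧ MeasureTheory.MeasurePreserving φ μ μ ∧
      -- (i) upper box dimension and nets
      BiLipGrowth.upperBoxDim (Set.univ : Set X) = ((d : ℝ) : EReal) ∧
      (∃ κ : ℝ, 0 < κ ∧ ∀ δ : ℝ, 0 < δ → ∃ s : Finset X,
        BiLipGrowth.IsNet δ s ∧ (s.card : ℝ) ≤ max 1 (κ * δ ^ (-d))) ∧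
      -- (ii) mixing at the speediest possible rate
      (∃ f : X → ℝ, (∃ K : NNReal, LipschitzWith K f) ∧ f ≠ 0 ∧ ∫ x, f x ∂μ = 0 ∧
        BiLipGrowth.Mixes μ φ f ∧
        ∀ k : ℤ, k ≠ 0 → BiLipGrowth.correlation μ φ f k = 0) ∧
      -- (iii) growth
      (∃ c₁ c₂ : ℝ, 0 < c₁ ∧ 0 < c₂ ∧ ∀ n : ℕ, 1 ≤ n →
        c₁ * (n : ℝ) ^ (1 / d) ≤ (BiLipGrowth.growthHat φ n : ℝ) ∧
        (BiLipGrowth.growthHat φ n : ℝ) ≤ c₂ * (n : ℝ) ^ (1 / d)) ∧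
      -- `(X, φ)` is the Rudin-Shapiro shift, with a metric that induces its topology
      ∃ h : X ≃ₜ BiLipGrowth.subshift BiLipGrowth.rudinShapiro,
        ∀ x : X, h (φ x) = BiLipGrowth.shift BiLipGrowth.rudinShapiro (h x) := by
  let : MeasurableSpace (BiLipGrowth.WindowSpace BiLipGrowth.rudinShapiro hd) := borel _
  have : BorelSpace (BiLipGrowth.WindowSpace BiLipGrowth.rudinShapiro hd) := ⟨rfl⟩
  obtain ⟨μ, hprob, hμ, hmean, hcorr⟩ := BiLipGrowth.exists_measure_windowSpace_rudinShapiro hd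
  have hcorr' : ∀ k : ℤ, k ≠ 0 → BiLipGrowth.correlation μ
      (BiLipGrowth.WindowSpace.shift BiLipGrowth.rudinShapiro hd)
      (BiLipGrowth.WindowSpace.origin hd) k = 0 := fun k hk => by
    rcases Int.natAbs_eq k with h | h <;> rw [h]
    · exact hcorr _ (by omega)
    · rw [BiLipGrowth.correlation_neg hμ, hcorr _ (by omega)]
  refine ⟨BiLipGrowth.WindowSpace BiLipGrowth.rudinShapiro hd, inferInstance, inferInstance,
    inferInstance, inferInstance, μ, BiLipGrowth.WindowSpace.shift BiLipGrowth.rudinShapiro hd,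
    hprob, BiLipGrowth.isOpenPosMeasure_of_measurePreserving_shift hd μ hμ,
    ⟨⟨(1 + 1) ^ (1 / d), ?_⟩, ⟨(1 + 1) ^ (1 / d), ?_⟩⟩, hμ, ?_, ?_, ?_, ?_, ?_⟩
  · simpa using BiLipGrowth.WindowSpace.lipschitzWith_shift_zpow BiLipGrowth.rudinShapiro hd
      (c := 1) (k := 1) (by simp)
  · have := BiLipGrowth.WindowSpace.lipschitzWith_shift_zpow BiLipGrowth.rudinShapiro hd
      (c := -1) (k := 1) (by simp)
    rwa [zpow_neg_one, Nat.cast_one] at this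
  · exact BiLipGrowth.upperBoxDim_eq_of_bounds hd (by positivity)
      (BiLipGrowth.exists_isNet_windowSpace_rudinShapiro hd)
      (BiLipGrowth.coverNum_windowSpace_rudinShapiro_ge hd)
  · exact ⟨128, by norm_num, BiLipGrowth.exists_isNet_windowSpace_rudinShapiro hd⟩
  · refine ⟨BiLipGrowth.WindowSpace.origin hd, ⟨2, BiLipGrowth.WindowSpace.lipschitzWith_origin hd⟩,
      fun h => ?_, hmean, ?_, hcorr'⟩
    · obtain ⟨x⟩ := BiLipGrowth.nonempty_windowSpace_rudinShapiro hd
      have := congrFun h x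
      simp [BiLipGrowth.WindowSpace.origin] at this
    · refine tendsto_const_nhds.congr' ?_
      filter_upwards [Filter.eventually_ge_atTop 1] with n hn
      exact (hcorr n hn).symm
  · refine ⟨1, 2 ^ (1 / d), one_pos, by positivity, fun n hn => ?_⟩
    have hn' : (1 : ℝ) ≤ n := by exact_mod_cast hn
    rw [BiLipGrowth.WindowSpace.growthHat_shift hd n hn,
      ← Real.mul_rpow (by norm_num) (by positivity)]
    push_cast
    rw [one_mul]
    exact ⟨Real.rpow_le_rpow (by positivity) (by linarith) (by positivity),
      Real.rpow_le_rpow (by positivity) (by linarith) (by positivity)⟩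
  · exact ⟨BiLipGrowth.WindowSpace.homeo BiLipGrowth.rudinShapiro hd, fun x => rfl⟩
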